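/- Let $\kappa$ be a regular uncountable cardinal. Write $[\kappa]^2:=\{(\alpha,\beta)\mid\alpha<\beta<\kappa\}$, and for $a,b\subseteq\kappa$ write $a<b$ if $\alpha<\beta$ for all $\alpha\in a$ and $\beta\in b$. Assume that $\mathrm{pl}_1(\kappa)$ holds, that is, there is a function $\mathbf t:[\kappa]^2\to[\kappa]^2$ such that - whenever $\mathbf t(\alpha,\beta)=(\alpha^*,\beta^*)$, we have $\alpha^*\le\alpha<\beta^*\le\beta$; - for every family $\mathcal A$ of $\kappa$ many pairwise disjoint finite subsets of $\kappa$ there is a stationary set $S\subseteq\kappa$ such that for all $\alpha^*<\beta^*$ in $S$ there are $a<b$ in $\mathcal A$ with $\mathbf t[a\times b]=\{(\alpha^*,\beta^*)\}$. Then for every (possibly finite) cardinal $\theta\le\kappa$ the following are equivalent: 1. $\kappa\nrightarrow[\kappa]^2_\theta$: there is a coloring $c:[\kappa]^2\to\theta$ such that for every cofinal $X\subseteq\kappa$ and every $\tau<\theta$ there are $x<y$ in $X$ with $c(x,y)=\tau$. 2. $\kappa\nrightarrow[\kappa;\kappa]^2_\theta$: there is a coloring $c:[\kappa]^2\to\theta$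 such that for all cofinal $X,Y\subseteq\kappa$ and every $\tau<\theta$ there are $x\in X$ and $y\in Y$ with $x<y$ and $c(x,y)=\tau$. 3. $\mathrm{pr}_1(\kappa,\kappa,\theta,\omega)$: there is a coloring $c:[\kappa]^2\to\theta$ such that for every $\sigma<\omega$, every family $\mathcal A$ of $\kappa$ many pairwise disjoint subsets of $\kappa$ of size $\sigma$, and every $i<\theta$ there are $a<b$ in $\mathcal A$ with $c[a\times b]=\{i\}$. 4. For every Abelian group $(G,+)$ of size $\kappa$ there is a coloring $d:G\to\theta$ such that for all $X,Y\subseteq G$ of size $\kappa$ and every $\tau<\theta$ there are $x\in X$ and $y\in Y$ with $d(x+y)=\tau$. -/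

import Mathlib

open Cardinal Ordinal

universe u

namespace Transfinite

/-- The cardinal `κ` regarded as an initial ordinal, that is, as the well-ordered set of all
ordinals below `κ`. -/
abbrev Points (κ : Cardinal.{u}) : Type u := κ.ord.ToType

/-- `[κ]²`, the set of all pairs `(α, β)` with `α < β < κ`. -/
abbrev Pairs (κ : Cardinal.{u}) : Type u := {p : Points κ × Points κ // p.1 < p.2}

/-- For sets of ordinals, `a < b`: every element of `a` is below every element of `b`. -/
def Below {κ : Cardinal.{u}} (a b : Set (Points κ)) : Prop :=
  ∀ α ∈ a, ∀ β ∈ b, α < β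

/-- `a ⊛ b`, the set of all `(α, β) ∈ a × b` with `α < β`. It is all of `a × b` when `a < b`. -/
def prodLT {κ : Cardinal.{u}} (a b : Set (Points κ)) : Set (Pairs κ) :=
  {p | p.1.1 ∈ a ∧ p.1.2 ∈ b}

/-- The principle `pl₁(κ)`. -/
def PlOne (κ : Cardinal.{u}) : Prop :=
  ∃ t : Pairs κ → Pairs κ,
    (∀ p : Pairs κ, (t p).1.1 ≤ p.1.1 ∧ p.1.1 < (t p).1.2 ∧ (t p).1.2 ≤ p.1.2) ∧
    ∀ A : Set (Set (Points κ)), #A = κ → (∀ a ∈ A, a.Finite) → A.PairwiseDisjoint id →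
      ∃ S : Set (Points κ), IsStationary S ∧
        ∀ q : Pairs κ, q.1.1 ∈ S → q.1.2 ∈ S →
          ∃ a ∈ A, ∃ b ∈ A, Below a b ∧ t '' prodLT a b = {q}

/-- The negative square-brackets relation `κ ↛ [κ]²_θ`. -/
def NegSquare (κ θ : Cardinal.{u}) : Prop :=
  ∃ c : Pairs κ → Points θ,
    ∀ X : Set (Points κ), IsCofinal X →
      ∀ τ : Points θ, ∃ p ∈ prodLT X X, c p = τ

/-- The negative rectangular square-brackets relation `κ ↛ [κ; κ]²_θ`. -/
def NegRect (κ θ : Cardinal.{u}) : Prop :=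
  ∃ c : Pairs κ → Points θ,
    ∀ X Y : Set (Points κ), IsCofinal X → IsCofinal Y →
      ∀ τ : Points θ, ∃ p ∈ prodLT X Y, c p = τ

/-- Shelah's principle `pr₁(κ, κ, θ, χ)`. The members of the family all have the same order type
`σ < χ`. -/
def PrOne (κ θ χ : Cardinal.{u}) : Prop :=
  ∃ c : Pairs κ → Points θ,
    ∀ σ : Ordinal.{u}, σ < χ.ord →
      ∀ A : Set (Set (Points κ)), #A = κ → (∀ a ∈ A, typeLT a = σ) → A.PairwiseDisjoint id →
        ∀ i : Points θ, ∃ a ∈ A, ∃ b ∈ A, Below a b ∧ c '' prodLT a b = {i}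

/-- Every Abelian group `G` of size `κ` admits a colouring `d : G → θ` such that all colours occur
on `X + Y` whenever `X, Y ⊆ G` have size `κ`. -/
def GroupColouring (κ θ : Cardinal.{u}) : Prop :=
  ∀ (G : Type u) [AddCommGroup G], #G = κ →
    ∃ d : G → Points θ,
      ∀ X Y : Set G, #X = κ → #Y = κ →
        ∀ τ : Points θ, ∃ x ∈ X, ∃ y ∈ Y, d (x + y) = τ

end Transfinite

/-!
Fix `t` witnessing `pl₁(κ)`. If `c` witnesses `κ ↛ [κ]²_θ`, then `c ∘ t` witnesses both the
rectangular relation and `pr₁(κ, κ, θ, ω)`: a family of finite sets yields a cofinal `S` all of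
whose pairs are constant values of `t` on rectangles of the family, and `c` takes every value on
`[S]²`. The converse implications need no `t`; the one from groups restricts a colouring of the
free Abelian group on `κ` to sums of two generators.

The substantial implication is the one to Abelian groups `G` of size `κ`. Enumerate `G` as
`(g α)_{α < κ}`. Finite sets of indices that are *saturated*, meaning that the relations expressing
a multiple of `g α` through earlier generators can be found inside the set, are closed under unions
and intersections, and the subgroups they generate intersect accordingly
(`Saturated.mem_span_inter`). Hence each `z : G` has a finite support, the least saturated set
whose generators span `z`. Given `X, Y ⊆ G` of size `κ`, the Δ-system lemma produces `x i ∈ X`,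
`y i ∈ Y` for which the support of `x i + y j` consists of a part of the root, a nonempty part of
the block of `i` and a nonempty part of the block of `j`. The transformation `t` can be prescribed
on the rectangle between two blocks; what remains is to recognise, from the support alone, a pair
that lies in it.

For this the colours carry a natural number as a second component. The pairs inside one block
together with the root can be assumed to have second component at most a fixed `n`, while the value
of `t` on the rectangle can be given any colour, so that choosing a pair of the support with the
largest second component finds the rectangle (`HitsRectangles.groupColouring`).

It remains to obtain a colouring in `θ × ω` colours from one in `θ` colours
(`exists_prod_colouring`). For infinite `θ` this is a bijection of the colours. For finite `θ` it
is enough that `pl₁(κ)` alone yields a colouring in `ω` colours. Since `t` raises neither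
coordinate, each pair reaches a fixed point after finitely many applications of `t`; call their
number its height. Applying `pl₁(κ)` repeatedly shows that the heights of the pairs from a cofinal
set contain arbitrarily long intervals (`HitsRectangles.exists_height_eq_add`), so the 2-adic
valuation of the height takes every value on every cofinal set.
-/

namespace Transfinite

variable {κ : Cardinal.{u}}

/-! ### Large subsets of a regular cardinal -/

theorem mk_eq_of_isCofinal (hreg : κ.IsRegular) {s : Set (Points κ)} (hs : IsCofinal s) :
    #s = κ := by
  refine le_antisymm ((mk_set_le s).trans (by simp)) ?_
  have := Order.cof_le hs
  rwa [cof_toType, hreg.cof_ord] at this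

theorem isCofinal_of_mk_eq {s : Set (Points κ)} (hs : #s = κ) : IsCofinal s := by
  by_contra h
  obtain ⟨x, hx⟩ := not_isCofinal_iff.1 h
  have h1 : #s ≤ #(Set.Iio x) := mk_le_mk_of_subset fun y hy => hx y hy
  exact absurd (hs ▸ h1) (not_le.2 (by simpa using mk_Iio_lt x (by simp)))

theorem exists_gt_of_isCofinal (hreg : κ.IsRegular) {s : Set (Points κ)} (hs : IsCofinal s)
    (x : Points κ) : ∃ y ∈ s, x < y := by
  have : NoMaxOrder (Points κ) := noMaxOrder hreg.aleph0_le
  obtain ⟨z, hz⟩ := exists_gt x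
  obtain ⟨y, hy, hzy⟩ := hs z
  exact ⟨y, hy, hz.trans_le hzy⟩

theorem isCofinal_of_isStationary {s : Set (Points κ)} (hs : IsStationary s) : IsCofinal s := by
  by_contra h
  obtain ⟨x, hx⟩ := not_isCofinal_iff.1 h
  have hc : IsClub (Set.Ici x) := by
    refine ⟨?_, fun y => ⟨max x y, Set.mem_Ici.2 (le_max_left x y), le_max_right x y⟩⟩
    intro d hd ⟨y, hy⟩ _ a ha
    exact (hd hy : x ≤ y).trans (ha.1 hy)
  obtain ⟨y, hy, hxy⟩ := hs hc
  exact absurd (hx y hy) (not_lt.2 hxy)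

/-- A function from a set of regular size `κ` to a smaller type is constant on a subset of
size `κ`. -/
theorem exists_subset_constant (hreg : κ.IsRegular) {ι C : Type u} {I : Set ι} (hI : #I = κ)
    (f : ι → C) (hC : #C < κ) : ∃ c : C, ∃ J ⊆ I, #J = κ ∧ ∀ i ∈ J, f i = c := by
  obtain ⟨c, J, hJ, hκ, hc⟩ := infinite_pigeonhole_set (s := I) (fun i => f i) κ hI.ge
    hreg.aleph0_le (by rwa [hreg.cof_ord])
  exact ⟨c, J, hJ, le_antisymm (hI ▸ mk_le_mk_of_subset hJ) hκ, fun i hi => hc hi⟩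

theorem exists_subset_constant_nat (hreg : κ.IsRegular) (hunc : ℵ₀ < κ) {ι : Type u} {I : Set ι}
    (hI : #I = κ) (f : ι → ℕ) : ∃ n : ℕ, ∃ J ⊆ I, #J = κ ∧ ∀ i ∈ J, f i = n := by
  obtain ⟨n, J, hJ, hκ, hn⟩ := exists_subset_constant hreg hI (fun i => ULift.up.{u} (f i))
    (by simpa using hunc)
  exact ⟨n.down, J, hJ, hκ, fun i hi => congrArg ULift.down (hn i hi)⟩

theorem mk_diff_eq (hreg : κ.IsRegular) {ι : Type u} {I B : Set ι} (hI : #I = κ) (hB : #B < κ) :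
    #(I \ B : Set ι) = κ := by
  refine le_antisymm (hI ▸ mk_le_mk_of_subset Set.sdiff_subset) ?_
  by_contra h
  have h1 : #I ≤ #(I \ B : Set ι) + #B := le_mk_sdiff_add_mk I B
  exact absurd (hI ▸ h1) (not_le.2 (add_lt_of_lt hreg.aleph0_le (not_le.1 h) hB))

/-! ### Δ-systems of finite sets -/

/-- If every point lies in fewer than `κ` of the nonempty finite sets `a i`, then `κ` many of
them are pairwise disjoint: a maximal disjoint subfamily cannot be smaller. -/
theorem exists_pairwiseDisjoint (hreg : κ.IsRegular) {ι α : Type u} {I : Set ι} (hI : #I = κ)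
    (a : ι → Finset α) (hne : ∀ i ∈ I, (a i).Nonempty)
    (hsmall : ∀ x, #({i ∈ I | x ∈ a i} : Set ι) < κ) :
    ∃ J ⊆ I, #J = κ ∧ J.PairwiseDisjoint a := by
  obtain ⟨J, hJ⟩ := zorn_subset {J : Set ι | J ⊆ I ∧ J.PairwiseDisjoint a} (by
    intro c hc hchain
    refine ⟨⋃₀ c, ⟨Set.sUnion_subset fun s hs => (hc hs).1, ?_⟩, fun s hs =>
      Set.subset_sUnion_of_mem hs⟩
    exact (Set.pairwiseDisjoint_sUnion hchain.directedOn).2 fun s hs => (hc hs).2)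
  refine ⟨J, hJ.prop.1, ?_, hJ.prop.2⟩
  refine le_antisymm (hI ▸ mk_le_mk_of_subset hJ.prop.1) ?_
  by_contra hlt
  have hlt : #J < κ := not_le.1 hlt
  have hW : #(⋃ j ∈ J, (a j : Set α)) < κ :=
    (card_biUnion_lt_iff_forall_of_isRegular hreg hlt).2 fun j _ =>
      (Finset.finite_toSet (a j)).lt_aleph0.trans_le hreg.aleph0_le
  have hU : #(⋃ x ∈ (⋃ j ∈ J, (a j : Set α)), {i ∈ I | x ∈ a i}) < κ :=
    (card_biUnion_lt_iff_forall_of_isRegular hreg hW).2 fun x _ => hsmall x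
  refine absurd (mk_le_mk_of_subset ?_) (not_le.2 (hI.symm ▸ hU))
  intro i hi
  simp only [Set.mem_iUnion, exists_prop, Finset.mem_coe]
  by_cases hiJ : i ∈ J
  · obtain ⟨x, hx⟩ := hne i hi
    exact ⟨x, ⟨i, hiJ, hx⟩, hi, hx⟩
  · by_contra hcon
    refine hiJ (hJ.le_of_ge (y := insert i J) ⟨Set.insert_subset hi hJ.prop.1, ?_⟩
      (Set.subset_insert i J) (Set.mem_insert i J))
    refine hJ.prop.2.insert fun j hj _ => Finset.disjoint_left.2 fun x hxi hxj => ?_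
    exact hcon ⟨x, ⟨j, hj, hxj⟩, hi, hxi⟩

theorem exists_deltaSystem_of_card (hreg : κ.IsRegular) {ι α : Type u} [DecidableEq α] (n : ℕ) :
    ∀ (a : ι → Finset α) (I : Set ι), #I = κ → (∀ i ∈ I, (a i).card = n) →
    ∃ J ⊆ I, #J = κ ∧ ∃ r : Finset α, ∀ i ∈ J, ∀ j ∈ J, i ≠ j → a i ∩ a j = r := by
  induction n with
  | zero =>
    intro a I hI h
    refine ⟨I, subset_rfl, hI, ∅, fun i hi j _ _ => ?_⟩
    rw [Finset.card_eq_zero.1 (h i hi), Finset.empty_inter]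
  | succ n ih =>
    intro a I hI h
    by_cases hsmall : ∀ x, #({i ∈ I | x ∈ a i} : Set ι) < κ
    · obtain ⟨J, hJ, hκ, hd⟩ := exists_pairwiseDisjoint hreg hI a
        (fun i hi => Finset.card_pos.1 (by rw [h i hi]; omega)) hsmall
      exact ⟨J, hJ, hκ, ∅, fun i hi j hj hij => Finset.disjoint_iff_inter_eq_empty.1 (hd hi hj hij)⟩
    · push Not at hsmall
      obtain ⟨x, hx⟩ := hsmall
      obtain ⟨J, hJ, hκ, r, hr⟩ := ih (fun i => (a i).erase x) {i ∈ I | x ∈ a i}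
        (le_antisymm (hI ▸ mk_le_mk_of_subset fun i hi => hi.1) hx)
        (fun i hi => by rw [Finset.card_erase_of_mem hi.2, h i hi.1]; rfl)
      refine ⟨J, fun i hi => (hJ hi).1, hκ, insert x r, fun i hi j hj hij => ?_⟩
      rw [← hr i hi j hj hij]
      have hxi := (hJ hi).2
      have hxj := (hJ hj).2
      ext y
      by_cases hy : y = x
      · simp [hy, hxi, hxj]
      · simp [hy]

/-- The Δ-system lemma: any `κ` many finite sets, `κ` regular uncountable, contain `κ` many
whose pairwise intersections are all the same. -/
theorem exists_deltaSystem (hreg : κ.IsRegular) (hunc : ℵ₀ < κ) {ι α : Type u} [DecidableEq α]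
    {I : Set ι} (hI : #I = κ) (a : ι → Finset α) :
    ∃ J ⊆ I, #J = κ ∧ ∃ r : Finset α, ∀ i ∈ J, ∀ j ∈ J, i ≠ j → a i ∩ a j = r := by
  obtain ⟨n, I', hI', hκ', hn⟩ := exists_subset_constant_nat hreg hunc hI fun i => (a i).card
  obtain ⟨J, hJ, h⟩ := exists_deltaSystem_of_card hreg n a I' hκ' hn
  exact ⟨J, hJ.trans hI', h⟩

/-- Finite sets `a γ ⊆ (γ, κ)` can be thinned out to a disjoint family: every point lies in
fewer than `κ` of them. -/
theorem exists_pairwiseDisjoint_of_forall_lt (hreg : κ.IsRegular)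
    (a : Points κ → Finset (Points κ)) (hne : ∀ γ, (a γ).Nonempty)
    (ha : ∀ γ, ∀ α ∈ a γ, γ < α) :
    ∃ J : Set (Points κ), #J = κ ∧ J.PairwiseDisjoint a := by
  obtain ⟨J, -, h⟩ := exists_pairwiseDisjoint hreg (I := Set.univ) (by simp) a
    (fun γ _ => hne γ) fun x =>
      (mk_le_mk_of_subset (t := Set.Iio x) fun γ hγ => ha γ x hγ.2).trans_lt
      (by simpa using mk_Iio_lt x (by simp))
  exact ⟨J, h⟩

/-! ### Rectangles on which a transformation is constant -/

/-- The second clause in the definition of `pl₁(κ)`: every family of `κ` many pairwise disjoint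
finite sets admits a stationary `S` all of whose pairs are the constant value of `t` on a
rectangle of the family. -/
def HitsRectangles (t : Pairs κ → Pairs κ) : Prop :=
  ∀ A : Set (Set (Points κ)), #A = κ → (∀ a ∈ A, a.Finite) → A.PairwiseDisjoint id →
    ∃ S : Set (Points κ), IsStationary S ∧
      ∀ q : Pairs κ, q.1.1 ∈ S → q.1.2 ∈ S →
        ∃ a ∈ A, ∃ b ∈ A, Below a b ∧ t '' prodLT a b = {q}

/-- `HitsRectangles` for an indexed family; stationarity is only used through cofinality. -/
theorem HitsRectangles.exists_isCofinal {t : Pairs κ → Pairs κ} (ht : HitsRectangles t)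
    {ι : Type u} {I : Set ι} (hI : #I = κ) (a : ι → Finset (Points κ))
    (hne : ∀ i ∈ I, (a i).Nonempty) (hd : I.PairwiseDisjoint a) :
    ∃ S : Set (Points κ), IsCofinal S ∧ ∀ q : Pairs κ, q.1.1 ∈ S → q.1.2 ∈ S →
      ∃ i ∈ I, ∃ j ∈ I, i ≠ j ∧ (∀ α ∈ a i, ∀ β ∈ a j, α < β) ∧
        ∀ p : Pairs κ, p.1.1 ∈ a i → p.1.2 ∈ a j → t p = q := by
  have hinj : Set.InjOn (fun i => (a i : Set (Points κ))) I := by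
    intro i hi j hj hij
    by_contra hne'
    obtain ⟨x, hx⟩ := hne i hi
    exact Finset.disjoint_left.1 (hd hi hj hne') hx (Finset.coe_injective hij ▸ hx)
  obtain ⟨S, hS, h⟩ := ht ((fun i => (a i : Set (Points κ))) '' I)
    (by rw [mk_image_eq_of_injOn _ _ hinj, hI])
    (by rintro _ ⟨i, -, rfl⟩; exact (a i).finite_toSet)
    (by
      rintro _ ⟨i, hi, rfl⟩ _ ⟨j, hj, rfl⟩ hij
      exact Finset.disjoint_coe.2 (hd hi hj fun e => hij (by rw [e])))
  refine ⟨S, isCofinal_of_isStationary hS, fun q h1 h2 => ?_⟩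
  obtain ⟨_, ⟨i, hi, rfl⟩, _, ⟨j, hj, rfl⟩, hlt, hq⟩ := h q h1 h2
  refine ⟨i, hi, j, hj, ?_, fun α hα β hβ => hlt α hα β hβ, fun p h1 h2 => ?_⟩
  · rintro rfl
    obtain ⟨x, hx⟩ := hne i hi
    exact lt_irrefl x (hlt x hx x hx)
  · have : t p ∈ t '' prodLT (a i : Set (Points κ)) (a j) := ⟨p, ⟨h1, h2⟩, rfl⟩
    rw [hq] at this
    exact this

/-- Members of a family of finite sets may be chosen above every ordinal given in advance, so
`HitsRectangles` applies to every property that finite sets can have arbitrarily high up. -/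
theorem HitsRectangles.exists_isCofinal_of_forall {t : Pairs κ → Pairs κ} (hreg : κ.IsRegular)
    (ht : HitsRectangles t) (P : Finset (Points κ) → Prop)
    (hP : ∀ γ, ∃ a, P a ∧ a.Nonempty ∧ ∀ α ∈ a, γ < α) :
    ∃ S : Set (Points κ), IsCofinal S ∧ ∀ q : Pairs κ, q.1.1 ∈ S → q.1.2 ∈ S →
      ∃ a b : Finset (Points κ), P a ∧ P b ∧ ∀ α ∈ a, ∀ β ∈ b, ∃ p : Pairs κ,
        p.1 = (α, β) ∧ t p = q := by
  choose a haP hne ha using hP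
  obtain ⟨J, hJ, hd⟩ := exists_pairwiseDisjoint_of_forall_lt hreg a hne ha
  obtain ⟨S, hS, h⟩ := ht.exists_isCofinal hJ a (fun i _ => hne i) hd
  refine ⟨S, hS, fun q h1 h2 => ?_⟩
  obtain ⟨i, -, j, -, -, hlt, hq⟩ := h q h1 h2
  exact ⟨a i, a j, haP i, haP j, fun α hα β hβ => ⟨⟨(α, β), hlt α hα β hβ⟩, rfl, hq _ hα hβ⟩⟩

/-! ### Counting iterations of a transformation -/

/-- Iterating a transformation that does not raise either coordinate leads to a fixed point. -/
theorem exists_iterate_fixed {t : Pairs κ → Pairs κ}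
    (hdec : ∀ p : Pairs κ, (t p).1.1 ≤ p.1.1 ∧ (t p).1.2 ≤ p.1.2) (p : Pairs κ) :
    ∃ n, t (t^[n] p) = t^[n] p := by
  have key : ∀ x y : Points κ, ∀ p : Pairs κ, p.1.1 = x → p.1.2 = y →
      ∃ n, t (t^[n] p) = t^[n] p := by
    intro x
    induction x using WellFoundedLT.induction with
    | ind x ihx =>
    intro y
    induction y using WellFoundedLT.induction with
    | ind y ihy =>
    rintro p rfl rfl
    suffices t p = p ∨ ∃ n, t (t^[n] (t p)) = t^[n] (t p) by
      rcases this with h | ⟨n, h⟩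
      · exact ⟨0, h⟩
      · exact ⟨n + 1, h⟩
    rcases (hdec p).1.lt_or_eq with h1 | h1
    · exact Or.inr (ihx _ h1 _ _ rfl rfl)
    · rcases (hdec p).2.lt_or_eq with h2 | h2
      · exact Or.inr (ihy _ h2 _ h1 rfl)
      · exact Or.inl (Subtype.ext (Prod.ext h1 h2))
  exact key _ _ p rfl rfl

/-- The number of times `t` can be applied to `p` before a fixed point is reached. -/
noncomputable def height (t : Pairs κ → Pairs κ) (p : Pairs κ) : ℕ :=
  sInf {n | t (t^[n] p) = t^[n] p}

theorem height_eq_succ {t : Pairs κ → Pairs κ}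
    (hdec : ∀ p : Pairs κ, (t p).1.1 ≤ p.1.1 ∧ (t p).1.2 ≤ p.1.2) {p : Pairs κ} (hp : t p ≠ p) :
    height t p = height t (t p) + 1 := by
  have h1 := Nat.sInf_mem (s := {n | t (t^[n] p) = t^[n] p}) (exists_iterate_fixed hdec p)
  have h2 := Nat.sInf_mem (s := {n | t (t^[n] (t p)) = t^[n] (t p)})
    (exists_iterate_fixed hdec (t p))
  refine le_antisymm (Nat.sInf_le (m := height t (t p) + 1) h2) ?_
  change _ ≤ sInf _
  obtain ⟨m, hm⟩ : ∃ m, sInf {n | t (t^[n] p) = t^[n] p} = m + 1 := by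
    refine Nat.exists_eq_succ_of_ne_zero fun h0 => hp ?_
    rw [h0] at h1
    exact h1
  rw [hm] at h1 ⊢
  exact Nat.succ_le_succ (Nat.sInf_le h1)

/-- Every cofinal `X` admits a cofinal `S` such that the heights of pairs from `X` cover, for
each pair `q` from `S`, the `N` numbers that follow the height of `q`.

One application of `t` serves two cofinal sets at once, by using finite sets that meet both. Each
meets them in two points, so that one of these is not the first coordinate of `q` and the
corresponding pair is moved by `t`. -/
theorem HitsRectangles.exists_height_eq_add {t : Pairs κ → Pairs κ} (hreg : κ.IsRegular)
    (hdec : ∀ p : Pairs κ, (t p).1.1 ≤ p.1.1 ∧ (t p).1.2 ≤ p.1.2) (ht : HitsRectangles t)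
    {X : Set (Points κ)} (hX : IsCofinal X) (N : ℕ) :
    ∃ S : Set (Points κ), IsCofinal S ∧ ∀ q ∈ prodLT S S, ∀ i < N,
      ∃ p ∈ prodLT X X, height t p = height t q + (i + 1) := by
  classical
  induction N with
  | zero => exact ⟨X, hX, by simp⟩
  | succ N ih =>
    obtain ⟨S, hS, hSX⟩ := ih
    let P : Finset (Points κ) → Prop := fun a => ∀ Y ∈ ({X, S} : Set (Set (Points κ))),
      ∃ x ∈ Y, ∃ x' ∈ Y, x ∈ a ∧ x' ∈ a ∧ x ≠ x'
    obtain ⟨T, hT, h⟩ := ht.exists_isCofinal_of_forall hreg P (fun γ => by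
      obtain ⟨x, hx, hγx⟩ := exists_gt_of_isCofinal hreg hX γ
      obtain ⟨x', hx', hxx'⟩ := exists_gt_of_isCofinal hreg hX x
      obtain ⟨s, hs, hγs⟩ := exists_gt_of_isCofinal hreg hS γ
      obtain ⟨s', hs', hss'⟩ := exists_gt_of_isCofinal hreg hS s
      refine ⟨{x, x', s, s'}, ?_, ⟨x, by simp⟩, ?_⟩
      · rintro Y (rfl | rfl)
        · exact ⟨x, hx, x', hx', by simp, by simp, hxx'.ne⟩
        · exact ⟨s, hs, s', hs', by simp, by simp, hss'.ne⟩
      · simp only [Finset.mem_insert, Finset.mem_singleton]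
        rintro α (rfl | rfl | rfl | rfl)
        exacts [hγx, hγx.trans hxx', hγs, hγs.trans hss'])
    refine ⟨T, hT, fun q hq => ?_⟩
    obtain ⟨a, b, ha, hb, hab⟩ := h q hq.1 hq.2
    have step : ∀ Y ∈ ({X, S} : Set (Set (Points κ))),
        ∃ p ∈ prodLT Y Y, height t p = height t q + 1 := by
      intro Y hY
      obtain ⟨x, hx, x', hx', hxa, hxa', hxx'⟩ := ha Y hY
      obtain ⟨y, hy, -, -, hyb, -, -⟩ := hb Y hY
      obtain ⟨z, hz, hza, hzq⟩ : ∃ z ∈ Y, z ∈ a ∧ z ≠ q.1.1 := by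
        by_cases hxq : x = q.1.1
        · exact ⟨x', hx', hxa', hxq ▸ hxx'.symm⟩
        · exact ⟨x, hx, hxa, hxq⟩
      obtain ⟨p, hp, rfl⟩ := hab z hza y hyb
      refine ⟨p, ⟨by rwa [hp], by rwa [hp]⟩, height_eq_succ hdec fun e => hzq ?_⟩
      rw [e, hp]
    rintro (_ | i) hi
    · exact step X (by simp)
    · obtain ⟨p, hp, hpq⟩ := step S (by simp)
      obtain ⟨p', hp', hpp'⟩ := hSX p hp i (by omega)
      exact ⟨p', hp', by omega⟩

/-- Every block of `2 ^ (m + 2)` consecutive numbers has a member of 2-adic valuation `m`. -/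
theorem exists_padicValNat_two_eq (m k : ℕ) :
    ∃ i < 2 ^ (m + 2), padicValNat 2 (k + (i + 1)) = m := by
  have hlt : k % 2 ^ (m + 1) < 2 ^ (m + 1) := Nat.mod_lt _ (by positivity)
  have hdiv := Nat.div_add_mod k (2 ^ (m + 1))
  have hpos : 0 < 2 ^ m := by positivity
  refine ⟨2 ^ m + 2 ^ (m + 1) - k % 2 ^ (m + 1) - 1, by grind, ?_⟩
  have : k + (2 ^ m + 2 ^ (m + 1) - k % 2 ^ (m + 1) - 1 + 1)
      = 2 ^ m * (2 * (k / 2 ^ (m + 1) + 1) + 1) := by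
    have h1 : 2 ^ (m + 1) = 2 * 2 ^ m := by ring
    rw [h1] at hlt hdiv ⊢
    have h2 : 2 ^ m * (2 * (k / (2 * 2 ^ m) + 1) + 1)
        = 2 * 2 ^ m * (k / (2 * 2 ^ m)) + 3 * 2 ^ m := by ring
    omega
  rw [this, padicValNat.mul (by positivity) (by positivity), padicValNat.prime_pow,
    padicValNat.eq_zero_of_not_dvd (by omega), add_zero]

/-- A transformation witnessing `pl₁(κ)` gives a colouring of `[κ]²` in countably many colours
that takes every value on every cofinal set. -/
theorem HitsRectangles.exists_nat_colouring {t : Pairs κ → Pairs κ} (hreg : κ.IsRegular)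
    (hdec : ∀ p : Pairs κ, (t p).1.1 ≤ p.1.1 ∧ (t p).1.2 ≤ p.1.2) (ht : HitsRectangles t) :
    ∃ g : Pairs κ → ℕ, ∀ X : Set (Points κ), IsCofinal X → ∀ m, ∃ p ∈ prodLT X X, g p = m := by
  refine ⟨fun p => padicValNat 2 (height t p), fun X hX m => ?_⟩
  obtain ⟨S, hS, h⟩ := ht.exists_height_eq_add hreg hdec hX (2 ^ (m + 2))
  obtain ⟨x, hx, -⟩ := hS (Classical.choice (by
    rw [← mk_ne_zero_iff]; simpa using hreg.pos.ne'))
  obtain ⟨y, hy, hxy⟩ := exists_gt_of_isCofinal hreg hS x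
  obtain ⟨i, hi, hm⟩ := exists_padicValNat_two_eq m (height t ⟨(x, y), hxy⟩)
  obtain ⟨p, hp, hpi⟩ := h ⟨(x, y), hxy⟩ ⟨hx, hy⟩ i hi
  exact ⟨p, hp, by simp only [hpi, hm]⟩

/-- Under `pl₁(κ)`, a colouring witnessing `κ ↛ [κ]²_θ` can be refined to one in `θ × ω` colours:
for infinite `θ` this is a renaming of the colours, and for finite `θ` there is one in `ω` colours
to begin with. -/
theorem exists_prod_colouring {θ : Cardinal.{u}} {t : Pairs κ → Pairs κ} (hreg : κ.IsRegular)
    (hdec : ∀ p : Pairs κ, (t p).1.1 ≤ p.1.1 ∧ (t p).1.2 ≤ p.1.2) (ht : HitsRectangles t)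
    (h : NegSquare κ θ) :
    ∃ c : Pairs κ → Points θ × ℕ, ∀ X : Set (Points κ), IsCofinal X →
      ∀ τ n, ∃ p ∈ prodLT X X, c p = (τ, n) := by
  obtain ⟨c, hc⟩ := h
  rcases le_total ℵ₀ θ with hθ | hθ
  · obtain ⟨e⟩ : Nonempty (Points θ ≃ Points θ × ℕ) := by
      rw [← Cardinal.lift_mk_eq']
      simp [mul_aleph0_eq hθ]
    refine ⟨e ∘ c, fun X hX τ n => ?_⟩
    obtain ⟨p, hp, hpc⟩ := hc X hX (e.symm (τ, n))
    exact ⟨p, hp, by simp [hpc]⟩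
  · obtain ⟨g, hg⟩ := ht.exists_nat_colouring hreg hdec
    obtain ⟨p, -⟩ := hg Set.univ IsCofinal.univ 0
    have : Nonempty (Points θ) := ⟨c p⟩
    have : Countable (Points θ) := by rw [← mk_le_aleph0_iff]; simpa using hθ
    obtain ⟨f, hf⟩ := exists_surjective_nat (Points θ × ℕ)
    refine ⟨f ∘ g, fun X hX τ n => ?_⟩
    obtain ⟨m, hm⟩ := hf (τ, n)
    obtain ⟨p, hp, hpg⟩ := hg X hX m
    exact ⟨p, hp, by simp [hpg, hm]⟩

/-! ### Finite supports in an Abelian group -/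

section Support

variable {K G : Type*} [AddCommGroup G]

theorem span_image_mono (g : K → G) {u v : Finset K} (h : u ⊆ v) :
    Submodule.span ℤ (g '' u) ≤ Submodule.span ℤ (g '' v) :=
  Submodule.span_mono (Set.image_mono (Finset.coe_subset.2 h))

variable [LinearOrder K]

/-- For a family `g` of generators of `G` indexed by a well-order, a finite set `u` of indices is
saturated if every multiple of a generator `g α`, `α ∈ u`, that is a combination of generators of
smaller index is already a combination of such generators with index in `u`. -/
def Saturated (g : K → G) (u : Finset K) : Prop :=
  ∀ α ∈ u, ∀ m : ℤ, m • g α ∈ Submodule.span ℤ (g '' Set.Iio α) →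
    m • g α ∈ Submodule.span ℤ (g '' (u.filter (· < α) : Finset K))

variable {g : K → G}

theorem Saturated.union {u v : Finset K} (hu : Saturated g u) (hv : Saturated g v) :
    Saturated g (u ∪ v) := by
  intro α hα m hm
  rcases Finset.mem_union.1 hα with h | h
  · exact span_image_mono g (Finset.filter_subset_filter _ Finset.subset_union_left) (hu α h m hm)
  · exact span_image_mono g (Finset.filter_subset_filter _ Finset.subset_union_right) (hv α h m hm)

theorem Saturated.filter_lt {u : Finset K} (hu : Saturated g u) (α : K) :
    Saturated g (u.filter (· < α)) := by
  intro β hβ m hm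
  obtain ⟨hβu, hβα⟩ := Finset.mem_filter.1 hβ
  refine span_image_mono g (fun ξ hξ => ?_) (hu β hβu m hm)
  obtain ⟨hξu, hξβ⟩ := Finset.mem_filter.1 hξ
  exact Finset.mem_filter.2 ⟨Finset.mem_filter.2 ⟨hξu, hξβ.trans hβα⟩, hξβ⟩

/-- Every index lies in a saturated finite set. The multiples of `g α` lying below `α` are
generated by a single one, which involves finitely many smaller indices. -/
theorem exists_saturated [WellFoundedLT K] (g : K → G) (α : K) :
    ∃ u : Finset K, Saturated g u ∧ α ∈ u ∧ ∀ ξ ∈ u, ξ ≤ α := by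
  induction α using WellFoundedLT.induction with
  | ind α ih =>
  let H : Submodule ℤ ℤ :=
    (Submodule.span ℤ (g '' Set.Iio α)).comap (LinearMap.toSpanSingleton ℤ G (g α))
  obtain ⟨o, ho⟩ := (IsPrincipalIdealRing.principal H).principal
  have hoH : o • g α ∈ Submodule.span ℤ (g '' Set.Iio α) := by
    have : o ∈ H := ho ▸ Submodule.mem_span_singleton_self o
    simpa [H] using this
  obtain ⟨T, hT, hoT⟩ := Submodule.mem_span_finite_of_mem_span hoH
  classical
  obtain ⟨F, hF, rfl⟩ := Finset.subset_set_image_iff.1 hT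
  choose! w hw using ih
  have hbelow : ∀ ξ ∈ F.biUnion w, ξ < α := by
    intro ξ hξ
    obtain ⟨β, hβ, hξβ⟩ := Finset.mem_biUnion.1 hξ
    exact ((hw β (hF hβ)).2.2 ξ hξβ).trans_lt (hF hβ)
  have hsub : ∀ β ∈ insert α (F.biUnion w),
      F.biUnion w ⊆ (insert α (F.biUnion w)).filter (· < α) := fun _ _ ξ hξ =>
    Finset.mem_filter.2 ⟨Finset.mem_insert_of_mem hξ, hbelow ξ hξ⟩
  refine ⟨insert α (F.biUnion w), ?_, Finset.mem_insert_self _ _, ?_⟩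
  · intro β hβ m hm
    rcases Finset.mem_insert.1 hβ with rfl | hβF
    · have : m ∈ H := by simpa [H] using hm
      rw [ho] at this
      obtain ⟨k, rfl⟩ := Submodule.mem_span_singleton.1 this
      rw [smul_assoc]
      refine Submodule.smul_mem _ _ (span_image_mono g ?_ (by simpa using hoT))
      refine fun ξ hξ => hsub _ hβ (Finset.mem_biUnion.2 ⟨ξ, hξ, (hw ξ (hF hξ)).2.1⟩)
    · obtain ⟨γ, hγ, hβγ⟩ := Finset.mem_biUnion.1 hβF
      refine span_image_mono g (Finset.filter_subset_filter _ ?_) ((hw γ (hF hγ)).1 β hβγ m hm)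
      exact (Finset.subset_biUnion_of_mem w hγ).trans (Finset.subset_insert _ _)
  · intro ξ hξ
    rcases Finset.mem_insert.1 hξ with rfl | h
    · exact le_rfl
    · exact (hbelow ξ h).le

/-- Splitting off the generator of largest index. -/
theorem exists_sub_smul_mem {u : Finset K} {α : K} (hα : ∀ ξ ∈ u, ξ ≤ α) {z : G}
    (hz : z ∈ Submodule.span ℤ (g '' u)) :
    ∃ m : ℤ, z - m • g α ∈ Submodule.span ℤ (g '' (u.filter (· < α) : Finset K)) ∧
      (α ∉ u → m = 0) := by
  by_cases h : α ∈ u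
  · have hu : (u : Set K) = insert α ((u.filter (· < α) : Finset K) : Set K) := by
      ext ξ
      simp only [Finset.mem_coe, Set.mem_insert_iff, Finset.mem_filter]
      refine ⟨fun hξ => (hα ξ hξ).eq_or_lt.imp_right fun hlt => ⟨hξ, hlt⟩, ?_⟩
      rintro (rfl | hξ)
      exacts [h, hξ.1]
    rw [hu, Set.image_insert_eq, Submodule.mem_span_insert'] at hz
    obtain ⟨m, hm⟩ := hz
    exact ⟨-m, by simpa using hm, fun h' => absurd h h'⟩
  · refine ⟨0, ?_, fun _ => rfl⟩
    have := span_image_mono g (fun ξ hξ => Finset.mem_filter.2 ⟨hξ, (hα ξ hξ).lt_of_ne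
      fun e => h (e ▸ hξ)⟩) hz
    simpa using this

theorem span_filter_lt_le (g : K → G) (u : Finset K) (α : K) :
    Submodule.span ℤ (g '' (u.filter (· < α) : Finset K)) ≤ Submodule.span ℤ (g '' Set.Iio α) :=
  Submodule.span_mono (Set.image_mono fun _ hξ => (Finset.mem_filter.1 hξ).2)

theorem Saturated.mem_span_inter_of_mem {u v : Finset K} {α : K} (hu : Saturated g u)
    (hαu : α ∈ u) (hu' : ∀ ξ ∈ u, ξ ≤ α) (hv' : ∀ ξ ∈ v, ξ ≤ α)
    (ih : ∀ y, y ∈ Submodule.span ℤ (g '' (u.filter (· < α) : Finset K)) →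
      y ∈ Submodule.span ℤ (g '' (v.filter (· < α) : Finset K)) →
      y ∈ Submodule.span ℤ (g '' (u.filter (· < α) ∩ v.filter (· < α) : Finset K)))
    {z : G} (hzu : z ∈ Submodule.span ℤ (g '' u)) (hzv : z ∈ Submodule.span ℤ (g '' v)) :
    z ∈ Submodule.span ℤ (g '' (u ∩ v : Finset K)) := by
  obtain ⟨m, hm, -⟩ := exists_sub_smul_mem hu' hzu
  obtain ⟨n, hn, hn0⟩ := exists_sub_smul_mem hv' hzv
  have hdiff : (m - n) • g α ∈ Submodule.span ℤ (g '' Set.Iio α) := by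
    have := sub_mem (span_filter_lt_le g v α hn) (span_filter_lt_le g u α hm)
    convert this using 1
    rw [sub_smul]
    abel
  have hn' : z - n • g α ∈ Submodule.span ℤ (g '' (u.filter (· < α) : Finset K)) := by
    have := add_mem hm (hu α hαu _ hdiff)
    convert this using 1
    rw [sub_smul]
    abel
  have hmem := span_image_mono g (Finset.inter_subset_inter (Finset.filter_subset _ _)
    (Finset.filter_subset _ _)) (ih _ hn' hn)
  by_cases hαv : α ∈ v
  · have hg : g α ∈ Submodule.span ℤ (g '' (u ∩ v : Finset K)) :=
      Submodule.subset_span ⟨α, Finset.mem_coe.2 (Finset.mem_inter.2 ⟨hαu, hαv⟩), rfl⟩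
    simpa using add_mem hmem (Submodule.smul_mem _ n hg)
  · simpa [hn0 hαv] using hmem

/-- The subgroups generated by saturated sets intersect like the sets themselves. -/
theorem Saturated.mem_span_inter {u v : Finset K} (hu : Saturated g u) (hv : Saturated g v)
    {z : G} (hzu : z ∈ Submodule.span ℤ (g '' u)) (hzv : z ∈ Submodule.span ℤ (g '' v)) :
    z ∈ Submodule.span ℤ (g '' (u ∩ v : Finset K)) := by
  induction hn : (u ∪ v).card using Nat.strong_induction_on generalizing u v z with
  | _ n ih =>
  rcases (u ∪ v).eq_empty_or_nonempty with he | hne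
  · obtain ⟨rfl, rfl⟩ := Finset.union_eq_empty.1 he
    simpa using hzu
  · obtain ⟨α, hα, hmax⟩ := (u ∪ v).exists_max_image id hne
    have hu' : ∀ ξ ∈ u, ξ ≤ α := fun ξ hξ => hmax ξ (Finset.mem_union_left _ hξ)
    have hv' : ∀ ξ ∈ v, ξ ≤ α := fun ξ hξ => hmax ξ (Finset.mem_union_right _ hξ)
    have hlt : (u.filter (· < α) ∪ v.filter (· < α)).card < n := by
      rw [← hn, ← Finset.filter_union]
      exact Finset.card_lt_card (Finset.filter_ssubset.2 ⟨α, hα, lt_irrefl α⟩)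
    have ih' := fun y hyu hyv => ih _ hlt (hu.filter_lt α) (hv.filter_lt α) (z := y) hyu hyv rfl
    rcases Finset.mem_union.1 hα with h | h
    · exact hu.mem_span_inter_of_mem h hu' hv' ih' hzu hzv
    · rw [Finset.inter_comm]
      refine hv.mem_span_inter_of_mem h hv' hu' (fun y hyv hyu => ?_) hzv hzu
      rw [Finset.inter_comm]
      exact ih' y hyu hyv

theorem Saturated.inter {u v : Finset K} (hu : Saturated g u) (hv : Saturated g v) :
    Saturated g (u ∩ v) := by
  intro α hα m hm
  obtain ⟨hαu, hαv⟩ := Finset.mem_inter.1 hα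
  rw [Finset.filter_inter_distrib]
  exact (hu.filter_lt α).mem_span_inter (hv.filter_lt α) (hu α hαu m hm) (hv α hαv m hm)

/-- If `g` enumerates `G`, then every element has a least saturated set of indices whose
generators span it. -/
theorem exists_support [WellFoundedLT K] (hg : Function.Surjective g) (z : G) :
    ∃ u : Finset K, Saturated g u ∧ z ∈ Submodule.span ℤ (g '' u) ∧
      ∀ v, Saturated g v → z ∈ Submodule.span ℤ (g '' v) → u ⊆ v := by
  obtain ⟨α, rfl⟩ := hg z
  obtain ⟨w, hw, hαw, -⟩ := exists_saturated g α
  obtain ⟨u, ⟨hu, hzu⟩, hmin⟩ := WellFounded.has_min (wellFounded_lt (α := Finset K))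
    {u | Saturated g u ∧ g α ∈ Submodule.span ℤ (g '' u)}
    ⟨w, hw, Submodule.subset_span ⟨α, hαw, rfl⟩⟩
  refine ⟨u, hu, hzu, fun v hv hzv => ?_⟩
  by_contra hsub
  refine hmin (u ∩ v) ⟨hu.inter hv, hu.mem_span_inter hv hzu hzv⟩ ?_
  exact lt_of_le_of_ne Finset.inter_subset_left fun h => hsub (Finset.inter_eq_left.1 h)

end Support

/-! ### Colouring Abelian groups -/

theorem finite_pairs (u : Finset (Points κ)) : {p : Pairs κ | p.1.1 ∈ u ∧ p.1.2 ∈ u}.Finite := by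
  refine ((u ×ˢ u).finite_toSet.preimage Subtype.val_injective.injOn).subset fun p hp => ?_
  simpa using hp

open Classical in
/-- The first coordinate of the colour, under `c`, of a pair from `u` for which the second
coordinate is largest; a default value when `u` has no pairs. -/
noncomputable def dominantColour {Θ : Type*} [Nonempty Θ] (c : Pairs κ → Θ × ℕ)
    (u : Finset (Points κ)) : Θ :=
  if h : ∃ p : Pairs κ, (p.1.1 ∈ u ∧ p.1.2 ∈ u) ∧
      ∀ p' : Pairs κ, p'.1.1 ∈ u ∧ p'.1.2 ∈ u → (c p').2 ≤ (c p).2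
  then (c h.choose).1 else Classical.arbitrary Θ

/-- A pair whose second colour is large identifies the dominant colour, provided that all other
pairs share its colour or have small second colour. -/
theorem dominantColour_eq {Θ : Type*} [Nonempty Θ] {c : Pairs κ → Θ × ℕ} {u : Finset (Points κ)}
    {p : Pairs κ} {n : ℕ} (hp : p.1.1 ∈ u ∧ p.1.2 ∈ u) (hn : n < (c p).2)
    (h : ∀ p' : Pairs κ, p'.1.1 ∈ u ∧ p'.1.2 ∈ u → c p' = c p ∨ (c p').2 ≤ n) :
    dominantColour c u = (c p).1 := by
  have hex : ∃ p : Pairs κ, (p.1.1 ∈ u ∧ p.1.2 ∈ u) ∧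
      ∀ p' : Pairs κ, p'.1.1 ∈ u ∧ p'.1.2 ∈ u → (c p').2 ≤ (c p).2 := by
    refine ⟨p, hp, fun p' hp' => ?_⟩
    rcases h p' hp' with h | h
    · rw [h]
    · omega
  rw [dominantColour, dif_pos hex]
  obtain ⟨hmem, hmax⟩ := hex.choose_spec
  rcases h _ hmem with h | h
  · rw [h]
  · have := hmax p hp
    omega

/-- The group colouring. The dominant colour of the support of `x + y`, with respect to `c ∘ t`,
is controlled as follows: after thinning out, the supports of the pairs `(x i, y i)` form a
Δ-system whose root does not span any `x i` or `y i`, and all pairs inside one of these supports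
have second colour at most `n`. The support of `x i + y j` then meets both the supports of index
`i` and `j` off the root, and `t` can be made constant on the resulting rectangle, with a value
whose second colour exceeds `n`. -/
theorem HitsRectangles.groupColouring {θ : Cardinal.{u}} (hreg : κ.IsRegular) (hunc : ℵ₀ < κ)
    {t : Pairs κ → Pairs κ} (ht : HitsRectangles t) {c : Pairs κ → Points θ × ℕ}
    (hc : ∀ X : Set (Points κ), IsCofinal X → ∀ τ n, ∃ p ∈ prodLT X X, c p = (τ, n)) :
    GroupColouring κ θ := by
  classical
  intro G _ hG
  obtain ⟨e⟩ : Nonempty (Points κ ≃ G) := by rw [← Cardinal.eq, hG]; simp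
  choose supp hsat hspan hleast using exists_support (g := e) e.surjective
  rcases isEmpty_or_nonempty (Points θ) with hθ | hθ
  · obtain ⟨x, hx, -⟩ := exists_gt_of_isCofinal hreg IsCofinal.univ (e.symm 0)
    obtain ⟨y, -, hxy⟩ := exists_gt_of_isCofinal hreg IsCofinal.univ x
    exact (hθ.false (c ⟨(x, y), hxy⟩).1).elim
  refine ⟨fun z => dominantColour (c ∘ t) (supp z), fun X Y hX hY τ => ?_⟩
  obtain ⟨ex⟩ : Nonempty (Points κ ≃ X) := by rw [← Cardinal.eq, hX]; simp
  obtain ⟨ey⟩ : Nonempty (Points κ ≃ Y) := by rw [← Cardinal.eq, hY]; simp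
  let x : Points κ → G := fun i => ex i
  let y : Points κ → G := fun i => ey i
  have hx : Function.Injective x := Subtype.val_injective.comp ex.injective
  have hy : Function.Injective y := Subtype.val_injective.comp ey.injective
  let w : Points κ → Finset (Points κ) := fun i => supp (x i) ∪ supp (y i)
  have hw : ∀ i, Saturated e (w i) := fun i => (hsat _).union (hsat _)
  have hxw : ∀ i, x i ∈ Submodule.span ℤ (e '' w i) := fun i =>
    span_image_mono e Finset.subset_union_left (hspan (x i))
  have hyw : ∀ i, y i ∈ Submodule.span ℤ (e '' w i) := fun i =>
    span_image_mono e Finset.subset_union_right (hspan (y i))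
  obtain ⟨J, -, hJ, r, hr⟩ := exists_deltaSystem hreg hunc (I := Set.univ) (by simp) w
  have hbdd : ∀ i, ∃ n, ∀ p : Pairs κ, p.1.1 ∈ w i ∧ p.1.2 ∈ w i → (c (t p)).2 ≤ n := fun i => by
    obtain ⟨n, hn⟩ := ((finite_pairs (w i)).image fun p => (c (t p)).2).bddAbove
    exact ⟨n, fun p hp => hn ⟨p, hp, rfl⟩⟩
  choose b hb using hbdd
  obtain ⟨n, J', hJ', hκ, hn⟩ := exists_subset_constant_nat hreg hunc hJ b
  have hcount : (Submodule.span ℤ (e '' r) : Set G).Countable := by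
    have : Countable (Submodule.span ℤ (Set.range fun i : r => e i)) := inferInstance
    rw [Set.range_comp' e, Subtype.range_coe] at this
    exact this
  let B : Set (Points κ) := {i | x i ∈ Submodule.span ℤ (e '' r) ∨ y i ∈ Submodule.span ℤ (e '' r)}
  have hB : #B < κ := by
    refine lt_of_le_of_lt (Set.Countable.le_aleph0 ?_) hunc
    exact (hcount.preimage hx).union (hcount.preimage hy)
  have hI := mk_diff_eq hreg hκ hB
  have hrI : ∀ i ∈ J' \ B, ∀ j ∈ J' \ B, i ≠ j → w i ∩ w j = r := fun i hi j hj =>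
    hr i (hJ' hi.1) j (hJ' hj.1)
  obtain ⟨S, hS, hSq⟩ := ht.exists_isCofinal hI (fun i => w i \ r)
    (fun i hi => by
      refine Finset.nonempty_iff_ne_empty.2 fun h => hi.2 (Or.inl ?_)
      exact span_image_mono e (Finset.sdiff_eq_empty_iff_subset.1 h) (hxw i))
    (fun i hi j hj hij => Finset.disjoint_left.2 fun α hα hα' => by
      rw [Finset.mem_sdiff] at hα hα'
      exact hα.2 (hrI i hi j hj hij ▸ Finset.mem_inter.2 ⟨hα.1, hα'.1⟩))
  obtain ⟨q, hq, hcq⟩ := hc S hS τ (n + 1)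
  obtain ⟨i, hi, j, hj, hij, hlt, htq⟩ := hSq q hq.1 hq.2
  refine ⟨x i, (ex i).2, y j, (ey j).2, ?_⟩
  have hsub : supp (x i + y j) ⊆ w i ∪ w j := hleast _ _ ((hw i).union (hw j))
    (add_mem (span_image_mono e Finset.subset_union_left (hxw i))
      (span_image_mono e Finset.subset_union_right (hyw j)))
  have hij' := hrI i hi j hj hij
  -- Otherwise `x i` would be spanned by both `w i` and `w j`, hence by the root.
  obtain ⟨α, hα, hαj⟩ : ∃ α ∈ supp (x i + y j), α ∉ w j := by
    by_contra! h
    have h1 : x i ∈ Submodule.span ℤ (e '' w j) := by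
      simpa using sub_mem (span_image_mono e h (hspan (x i + y j))) (hyw j)
    exact hi.2 (Or.inl (hij' ▸ (hw i).mem_span_inter (hw j) (hxw i) h1))
  obtain ⟨β, hβ, hβi⟩ : ∃ β ∈ supp (x i + y j), β ∉ w i := by
    by_contra! h
    have h1 : y j ∈ Submodule.span ℤ (e '' w i) := by
      simpa using sub_mem (span_image_mono e h (hspan (x i + y j))) (hxw i)
    exact hj.2 (Or.inr (hij' ▸ (hw i).mem_span_inter (hw j) h1 (hyw j)))
  have hoff : ∀ γ ∈ supp (x i + y j), (γ ∉ w j → γ ∈ w i \ r) ∧ (γ ∉ w i → γ ∈ w j \ r) := by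
    intro γ hγ
    have h1 := Finset.mem_union.1 (hsub hγ)
    rw [← hij']
    simp only [Finset.mem_sdiff, Finset.mem_inter]
    tauto
  have hαβ : α < β := hlt α ((hoff α hα).1 hαj) β ((hoff β hβ).2 hβi)
  have hval : t ⟨(α, β), hαβ⟩ = q := htq _ ((hoff α hα).1 hαj) ((hoff β hβ).2 hβi)
  change dominantColour (c ∘ t) (supp (x i + y j)) = τ
  rw [dominantColour_eq (p := ⟨(α, β), hαβ⟩) (n := n) ⟨hα, hβ⟩]
  · simp [hval, hcq]
  · simp [hval, hcq]
  · rintro p ⟨h1, h2⟩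
    simp only [Function.comp_apply, hval]
    -- A pair of the support inside `w i` or `w j` has small second colour. Any other pair has one
    -- coordinate in each block, in this order since the block of `i` lies below that of `j`.
    by_cases hpi : p.1.1 ∈ w i ∧ p.1.2 ∈ w i
    · exact Or.inr ((hb i p hpi).trans (hn i hi.1).le)
    by_cases hpj : p.1.1 ∈ w j ∧ p.1.2 ∈ w j
    · exact Or.inr ((hb j p hpj).trans (hn j hj.1).le)
    left
    by_cases h1j : p.1.1 ∈ w j
    · have h2j : p.1.2 ∉ w j := fun h => hpj ⟨h1j, h⟩
      have h2i := (hoff _ h2).1 h2j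
      have h1i : p.1.1 ∉ w i := fun h => hpi ⟨h, (Finset.mem_sdiff.1 h2i).1⟩
      exact absurd p.2 (hlt _ h2i _ ((hoff _ h1).2 h1i)).asymm
    · have h1i := (hoff _ h1).1 h1j
      have h2i : p.1.2 ∉ w i := fun h => hpi ⟨(Finset.mem_sdiff.1 h1i).1, h⟩
      rw [htq p h1i ((hoff _ h2).2 h2i)]

variable {θ : Cardinal.{u}}

/-! ### The equivalence -/

theorem HitsRectangles.negRect (hreg : κ.IsRegular) {t : Pairs κ → Pairs κ}
    (ht : HitsRectangles t) (h : NegSquare κ θ) : NegRect κ θ := by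
  classical
  obtain ⟨c, hc⟩ := h
  refine ⟨c ∘ t, fun X Y hX hY τ => ?_⟩
  obtain ⟨S, hS, h⟩ := ht.exists_isCofinal_of_forall hreg
    (fun a => (∃ x ∈ a, x ∈ X) ∧ ∃ y ∈ a, y ∈ Y) fun γ => by
      obtain ⟨x, hx, hγx⟩ := exists_gt_of_isCofinal hreg hX γ
      obtain ⟨y, hy, hγy⟩ := exists_gt_of_isCofinal hreg hY γ
      exact ⟨{x, y}, ⟨⟨x, by simp, hx⟩, y, by simp, hy⟩, ⟨x, by simp⟩, by simp [hγx, hγy]⟩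
  obtain ⟨q, hq, rfl⟩ := hc S hS τ
  obtain ⟨a, b, ⟨⟨x, hxa, hx⟩, -⟩, ⟨-, y, hyb, hy⟩, hab⟩ := h q hq.1 hq.2
  obtain ⟨p, hp, rfl⟩ := hab x hxa y hyb
  exact ⟨p, ⟨by rwa [hp], by rwa [hp]⟩, rfl⟩

theorem finite_of_typeLT_lt {α : Type u} [LinearOrder α] [WellFoundedLT α] {a : Set α}
    (h : typeLT a < (ℵ₀ : Cardinal.{u}).ord) : a.Finite := by
  have := Cardinal.lt_ord.1 h
  rw [card_type] at this
  exact lt_aleph0_iff_set_finite.1 this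

theorem HitsRectangles.prOne {t : Pairs κ → Pairs κ} (ht : HitsRectangles t)
    (h : NegSquare κ θ) : PrOne κ θ ℵ₀ := by
  obtain ⟨c, hc⟩ := h
  refine ⟨c ∘ t, fun σ hσ A hA hAσ hd τ => ?_⟩
  obtain ⟨S, hS, h⟩ := ht A hA (fun a ha => finite_of_typeLT_lt (hAσ a ha ▸ hσ)) hd
  obtain ⟨q, hq, rfl⟩ := hc S (isCofinal_of_isStationary hS) τ
  obtain ⟨a, ha, b, hb, hab, himg⟩ := h q hq.1 hq.2
  exact ⟨a, ha, b, hb, hab, by rw [Set.image_comp, himg, Set.image_singleton]⟩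

/-- Apply `pr₁` to a family of singletons. -/
theorem negSquare_of_prOne (hreg : κ.IsRegular) (h : PrOne κ θ ℵ₀) : NegSquare κ θ := by
  obtain ⟨c, hc⟩ := h
  refine ⟨c, fun X hX τ => ?_⟩
  obtain ⟨a, ha, b, hb, -, himg⟩ := hc 1 (by rw [ord_aleph0]; exact one_lt_omega0)
    ((fun x => ({x} : Set (Points κ))) '' X)
    (by rw [mk_image_eq Set.singleton_injective, mk_eq_of_isCofinal hreg hX])
    (by rintro _ ⟨x, -, rfl⟩; exact type_eq_one_of_unique _)
    (by
      rintro _ ⟨x, -, rfl⟩ _ ⟨y, -, rfl⟩ hxy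
      exact Set.disjoint_singleton.2 fun e => hxy (by rw [e])) τ
  obtain ⟨x, hx, rfl⟩ := ha
  obtain ⟨y, hy, rfl⟩ := hb
  have hτ : τ ∈ c '' prodLT {x} {y} := by rw [himg]; rfl
  obtain ⟨p, ⟨h1, h2⟩, hp⟩ := hτ
  rw [Set.mem_singleton_iff] at h1 h2
  exact ⟨p, ⟨by rwa [h1], by rwa [h2]⟩, hp⟩

/-- Restrict a colouring of the free Abelian group on `κ` to the sums of two generators. A cofinal
set is first split into two disjoint sets of size `κ`, so that no sum is of the form `x + x`. -/
theorem negSquare_of_groupColouring (hreg : κ.IsRegular) (h : GroupColouring κ θ) :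
    NegSquare κ θ := by
  have hinf : Infinite (Points κ) := by rw [infinite_iff]; simpa using hreg.aleph0_le
  obtain ⟨d, hd⟩ := h (Points κ →₀ ℤ) (by simp [hreg.aleph0_le])
  let e : Points κ → Points κ →₀ ℤ := fun α => Finsupp.single α 1
  have he : Function.Injective e := Finsupp.single_left_injective one_ne_zero
  refine ⟨fun p => d (e p.1.1 + e p.1.2), fun X hX τ => ?_⟩
  have hXκ := mk_eq_of_isCofinal hreg hX
  obtain ⟨f⟩ : Nonempty (Points κ ⊕ Points κ ≃ X) := by
    rw [← Cardinal.eq, hXκ]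
    simp [add_eq_self hreg.aleph0_le]
  let x : Points κ ⊕ Points κ → Points κ := fun i => f i
  have hx : Function.Injective x := Subtype.val_injective.comp f.injective
  have hsize : ∀ s : Points κ → Points κ ⊕ Points κ, Function.Injective s →
      #(Set.range (e ∘ x ∘ s)) = κ := fun s hs => by
    rw [mk_range_eq _ (he.comp (hx.comp hs))]
    simp
  obtain ⟨_, ⟨i, rfl⟩, _, ⟨j, rfl⟩, hτ⟩ :=
    hd _ _ (hsize _ Sum.inl_injective) (hsize _ Sum.inr_injective) τ
  have hxX : ∀ i, x i ∈ X := fun i => (f i).2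
  rcases (hx.ne (Sum.inl_ne_inr (a := i) (b := j))).lt_or_gt with hlt | hlt
  · exact ⟨⟨(x (Sum.inl i), x (Sum.inr j)), hlt⟩, ⟨hxX _, hxX _⟩, hτ⟩
  · refine ⟨⟨(x (Sum.inr j), x (Sum.inl i)), hlt⟩, ⟨hxX _, hxX _⟩, ?_⟩
    rw [add_comm] at hτ
    exact hτ

end Transfinite

theorem theoremA (κ θ : Cardinal.{u}) (hreg : κ.IsRegular) (hunc : ℵ₀ < κ) (hθ : θ ≤ κ)
    (hpl : Transfinite.PlOne κ) :
    List.TFAE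
      [Transfinite.NegSquare κ θ,
       Transfinite.NegRect κ θ,
       Transfinite.PrOne κ θ ℵ₀,
       Transfinite.GroupColouring κ θ] := by
  obtain ⟨t, hbetween, ht⟩ := hpl
  replace ht : Transfinite.HitsRectangles t := ht
  tfae_have 1 → 2 := ht.negRect hreg
  tfae_have 2 → 1 := fun ⟨c, hc⟩ => ⟨c, fun X hX => hc X X hX hX⟩
  tfae_have 1 → 3 := ht.prOne
  tfae_have 3 → 1 := Transfinite.negSquare_of_prOne hreg
  tfae_have 1 → 4 := fun h => by
    obtain ⟨c, hc⟩ := Transfinite.exists_prod_colouring hreg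
      (fun p => ⟨(hbetween p).1, (hbetween p).2.2⟩) ht h
    exact ht.groupColouring hreg hunc hc
  tfae_have 4 → 1 := Transfinite.negSquare_of_groupColouring hreg
  tfae_finish
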